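/- Let $\mathsf X\subseteq\mathbb R^d$ be open, let $K\subset\mathsf X$ be convex and compact, and let $F:\mathsf X\to\mathcal P(\mathbb R^d)$ be upper hemicontinuous (each $F(x)$ is nonempty and every open set containing $F(x)$ contains $F(z)$ for all $z$ near $x$), with convex compact values and locally bounded ($\bigcup_{x\in C}F(x)$ is bounded for every compact $C\subset\mathsf X$). Let $(x_k)_{k\ge0}\subset\mathsf X$ be a $K$-projected perturbed approximate discretization ($K$-PPAD) of $F$: there are points $y_k\in\mathsf X$, $k\ge1$, with $$x_k\in\Pi_K\bigl(x_{k-1}+\gamma_k\{F(y_k)+\eta_k\}\bigr),\qquad k\ge1,$$ where $\Pi_C$ denotes the nearest-point projection onto a closed convex set $C$ and $\Pi_C(A)=\{\Pi_C(a):a\in A\}$. Assume $\lim_k\|x_k-y_k\|=0$; $\gamma_k>0$, $\sum_{k\ge1}\gamma_k=\infty$ and $\lim_k\gamma_k=0$; and $\eta_k=e_k+r_k$, where $\lim_k\|r_k\|=0$, the series $\sum_{k\ge1}\gamma_ke_k$ converges, and $\sup_{k\ge1}\|e_k\|<\infty$. For $x\in K$ let $T_K(x)=\mathrm{cl}\{v\in\mathbb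 R^d:\exists\,\varepsilon>0,\ x+\varepsilon v\in K\}$ be the tangent cone of $K$ at $x$. Let $V:\mathsf X\to\mathbb R$ be locally Lipschitz and regular, i.e. for all $x\in\mathsf X$ and $h\in\mathbb R^d$ the limit $\lim_{\lambda\downarrow0}\lambda^{-1}(V(x+\lambda h)-V(x))$ exists and equals Clarke's generalized directional derivative $$V^0(x,h)=\limsup_{u\to0,\ \lambda\downarrow0}\lambda^{-1}\bigl(V(x+u+\lambda h)-V(x+u)\bigr).$$ Let $\bar\partial V(x)=\{w\in\mathbb R^d:\langle h,w\rangle\le V^0(x,h)\ \text{for all } h\in\mathbb R^d\}$ be the Clarke generalized gradient, and for a set-valued map $G$ let $$\mathcal L_GV(x)=\{a\in\mathbb R:\exists\,v\in G(x)\ \text{such that}\ \langle v,w\rangle=a\ \text{for all } w\in\bar\partial V(x)\}$$ be the set-valued Lie derivative. Suppose there is an upper semicontinuous function $U:\mathsf X\to\mathbb R$ such that, for all $x\in K$, $$\sup\mathcal L_{\Pi_{T_K}(F)}V(x)\le U(x)\le0,$$ where $\Pi_{T_K}(F)(x)=\Pi_{T_K(x)}(F(x))$ and $\sup\emptyset=-\infty$.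 Set $\mathcal S=\{x\in\mathsf X:U(x)=0\}$. Then: (i) The image under $V$ of the set of limit points of $(x_k)$ is a (nonempty) compact interval contained in $V(\mathcal S\cap K)$. (ii) If $V(\mathcal S\cap K)$ has empty interior in $\mathbb R$, then $x_k\to\mathcal S\cap K$; that is, $\mathcal S\cap K$ is nonempty and $\lim_{k\to\infty}\mathrm{dist}(x_k,\mathcal S\cap K)=0$. -/

import Mathlib

open Filter Topology Set

noncomputable section

/-- The state space `ℝ^d` with its Euclidean norm. -/
abbrev Eucl (d : ℕ) : Type := EuclideanSpace ℝ (Fin d)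

/-- The image `Π_C(A) = {Π_C(a) : a ∈ A}` of a set `A` under the nearest-point projection onto `C`
(for nonempty closed convex `C` every point has exactly one nearest point in `C`). -/
def projSet {d : ℕ} (C A : Set (Eucl d)) : Set (Eucl d) :=
  {p | p ∈ C ∧ ∃ a ∈ A, ∀ z ∈ C, dist a p ≤ dist a z}

/-- The tangent cone of a convex set `K` at `x`. -/
def convexTangentCone {d : ℕ} (K : Set (Eucl d)) (x : Eucl d) : Set (Eucl d) :=
  closure {v | ∃ ε : ℝ, 0 < ε ∧ x + ε • v ∈ K}

/-- The projected field `x ↦ Π_{T_K(x)}(F(x))`. -/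
def projField {d : ℕ} (K : Set (Eucl d)) (F : Eucl d → Set (Eucl d)) (x : Eucl d) :
    Set (Eucl d) :=
  projSet (convexTangentCone K x) (F x)

/-- Clarke's generalized directional derivative
`f⁰(x, h) = limsup_{u → 0, t ↓ 0} (f (x + u + t h) - f (x + u)) / t`
(a finite upper limit whenever `f` is Lipschitz near `x`). -/
def clarkeDeriv {d : ℕ} (f : Eucl d → ℝ) (x h : Eucl d) : ℝ :=
  limsup (fun p : Eucl d × ℝ => (f (x + p.1 + p.2 • h) - f (x + p.1)) / p.2)
    (𝓝 (0 : Eucl d) ×ˢ 𝓝[>] (0 : ℝ))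

/-- The Clarke generalized gradient. -/
def clarkeGradient {d : ℕ} (f : Eucl d → ℝ) (x : Eucl d) : Set (Eucl d) :=
  {w | ∀ h : Eucl d, inner ℝ h w ≤ clarkeDeriv f x h}

/-- `f` is regular at `x`: all one-sided directional derivatives exist and agree with the
generalized ones. -/
def ClarkeRegularAt {d : ℕ} (f : Eucl d → ℝ) (x : Eucl d) : Prop :=
  ∀ h : Eucl d,
    Tendsto (fun t : ℝ => (f (x + t • h) - f x) / t) (𝓝[>] 0) (𝓝 (clarkeDeriv f x h))

/-- The set-valued Lie derivative of `V` with respect to the set-valued field `G` at `x`. -/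
def lieDeriv {d : ℕ} (G : Eucl d → Set (Eucl d)) (V : Eucl d → ℝ) (x : Eucl d) : Set ℝ :=
  {a | ∃ v ∈ G x, ∀ w ∈ clarkeGradient V x, inner ℝ v w = a}

/-- Assumption on the field: `X` is open and `F` is upper hemicontinuous on `X` with nonempty convex
compact values, and bounded on compact subsets of `X`. Only the values of `F` on `X` matter. -/
structure FieldAssumption {d : ℕ} (X : Set (Eucl d)) (F : Eucl d → Set (Eucl d)) : Prop where
  isOpen : IsOpen X
  nonempty : ∀ x ∈ X, (F x).Nonempty
  upperHemicontinuousOn : UpperHemicontinuousOn F X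
  convex : ∀ x ∈ X, Convex ℝ (F x)
  isCompact : ∀ x ∈ X, IsCompact (F x)
  locallyBounded : ∀ C : Set (Eucl d), IsCompact C → C ⊆ X → Bornology.IsBounded (⋃ x ∈ C, F x)

/-- Assumption on the step sizes `γ 1, γ 2, …`. -/
structure StepAssumption (γ : ℕ → ℝ) : Prop where
  pos : ∀ k, 1 ≤ k → 0 < γ k
  sum_diverges : Tendsto (fun n => ∑ k ∈ Finset.Icc 1 n, γ k) atTop atTop
  tendsto_zero : Tendsto γ atTop (𝓝 0)

/-- Assumption on the noise `η 1, η 2, …`, with its decomposition `η = e + r`. -/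
structure NoiseAssumption {d : ℕ} (γ : ℕ → ℝ) (η e r : ℕ → Eucl d) : Prop where
  decomp : ∀ k, 1 ≤ k → η k = e k + r k
  tendsto_zero : Tendsto (fun k => ‖r k‖) atTop (𝓝 0)
  series_converges : ∃ s : Eucl d, Tendsto (fun n => ∑ k ∈ Finset.Icc 1 n, γ k • e k) atTop (𝓝 s)

/-- Assumption on the approximation sequence `y 1, y 2, …`. -/
structure ApproxAssumption {d : ℕ} (X : Set (Eucl d)) (x y : ℕ → Eucl d) : Prop where
  mem : ∀ k, 1 ≤ k → y k ∈ X
  tendsto_zero : Tendsto (fun k => ‖x k - y k‖) atTop (𝓝 0)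

/-- `(x k)_{k ≥ 0}` in `X` is a `K`-projected perturbed approximate discretization of `F` with noise
`η`, step sizes `γ` and approximation sequence `y`:
`x (k+1) ∈ Π_K (x k + γ (k+1) {F (y (k+1)) + η (k+1)})`. -/
structure IsPPAD {d : ℕ} (X K : Set (Eucl d)) (F : Eucl d → Set (Eucl d))
    (x y : ℕ → Eucl d) (γ : ℕ → ℝ) (η : ℕ → Eucl d) : Prop where
  mem : ∀ k, x k ∈ X
  step : ∀ k, x (k + 1) ∈
    projSet K ((fun v => x k + γ (k + 1) • (v + η (k + 1))) '' F (y (k + 1)))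

/-- The limit points (limits of subsequences) of a sequence. -/
def limitPoints {d : ℕ} (x : ℕ → Eucl d) : Set (Eucl d) :=
  {p | ∃ φ : ℕ → ℕ, StrictMono φ ∧ Tendsto (fun k => x (φ k)) atTop (𝓝 p)}

end

/-! Each projected step is written as an unprojected step minus `γ k • n k`, with `n k` normal to
`K` at `x k`. Comparing the projection with the previous iterate bounds `n k`, and the noise `e`
telescopes through its convergent partial sums `E` (`IsPPAD.exists_normalRecursion`). Shifted
interpolations then converge to Lipschitz curves `z` in `K` with `z' ∈ F z - N_K z` wherever `z'`
exists at a positive time (`exists_limit_trajectory`).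

As `z` stays in `K` before and after `t`, both `z' t` and `-z' t` are tangent. The normal part is
thus orthogonal to `z' t`, which is the projection of a field vector
(`mem_projField_of_hasDerivAt`). Regularity puts `(V ∘ z)'` in the Lie derivative, so `V` drops at
once from any point where `U < 0` (`ProjectedLyapunov.eventually_lt`).

If `V` is constant on the limit points, such a drop would lead to another limit point with a smaller
value, so `U` vanishes there. Otherwise each level strictly between the extreme values is crossed
upwards infinitely often; at a limit of last indices below the level the drop would contradict the
crossing, so `U = 0` there too (`exists_limitPoint_of_frequently`). Compactness of `S ∩ K` supplies
the endpoints. -/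

/-! ### Elapsed time and approximate field-normal pairs -/

/-- The time `γ 1 + ⋯ + γ k` elapsed after `k` steps. -/
noncomputable def elapsed (γ : ℕ → ℝ) (k : ℕ) : ℝ := ∑ i ∈ Finset.Icc 1 k, γ i

lemma elapsed_succ (γ : ℕ → ℝ) (k : ℕ) : elapsed γ (k + 1) = elapsed γ k + γ (k + 1) :=
  Finset.sum_Icc_succ_top (by omega) _

lemma StepAssumption.elapsed_strictMono {γ : ℕ → ℝ} (hγ : StepAssumption γ) :
    StrictMono (elapsed γ) :=
  strictMono_nat_of_lt_succ fun k => by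
    rw [elapsed_succ]
    linarith [hγ.pos (k + 1) (by omega)]

lemma StepAssumption.exists_index {γ : ℕ → ℝ} (hγ : StepAssumption γ) {j : ℕ} {s : ℝ}
    (hs : elapsed γ j ≤ s) : ∃ k, j ≤ k ∧ elapsed γ k ≤ s ∧ s < elapsed γ (k + 1) := by
  have hex : ∃ n, s < elapsed γ n := (hγ.sum_diverges.eventually_gt_atTop s).exists
  classical
  have h1 := Nat.find_spec hex
  have h2 : j < Nat.find hex := hγ.elapsed_strictMono.lt_iff_lt.1 (hs.trans_lt h1)
  obtain ⟨k, hk⟩ : ∃ k, Nat.find hex = k + 1 := ⟨Nat.find hex - 1, by omega⟩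
  refine ⟨k, by omega, not_lt.1 (Nat.find_min hex (m := k) (by omega)), hk ▸ h1⟩

/-- The recursion `x (k+1) = x k + γ (k+1) (g (k+1) - n (k+1)) + (E (k+1) - E k)`, where `g k` is
asymptotically in the field `F`, `n k` is normal to `K` at `x k` and `E` converges. -/
structure NormalRecursion {d : ℕ} (K : Set (Eucl d)) (F : Eucl d → Set (Eucl d))
    (x g n E : ℕ → Eucl d) (γ : ℕ → ℝ) (M : ℝ) (N : ℕ) : Prop where
  mem : ∀ k, N ≤ k → x k ∈ K
  step : ∀ k, N ≤ k → x (k + 1) - x k = γ (k + 1) • (g (k + 1) - n (k + 1)) + (E (k + 1) - E k)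
  norm_field : ∀ k, N < k → ‖g k‖ ≤ M
  norm_normal : ∀ k, N < k → ‖n k‖ ≤ M
  normal : ∀ k, N < k → ∀ w ∈ K, inner ℝ (n k) (w - x k) ≤ 0
  field : ∀ p ∈ K, ∀ ε : ℝ, 0 < ε → ∃ δ : ℝ, 0 < δ ∧
    ∀ᶠ k in atTop, dist (x k) p < δ → g k ∈ Metric.cthickening ε (F p)
  converges : ∃ s, Tendsto E atTop (𝓝 s)

/-- Pairs of a vector close to `A` and a bounded vector that is almost normal to `K` at `p`. -/
def approxPairs {d : ℕ} (K A : Set (Eucl d)) (M ε : ℝ) (p : Eucl d) : Set (Eucl d × Eucl d) :=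
  {c | c.1 ∈ Metric.cthickening ε A ∧ ‖c.2‖ ≤ M ∧ ∀ w ∈ K, inner ℝ c.2 (w - p) ≤ ε}

section
variable {d : ℕ} {K A : Set (Eucl d)} {M ε : ℝ} {p : Eucl d}

/-- Normality is relaxed to a tolerance at one fixed `p` so that step-weighted averages over varying
base points remain admissible. -/
lemma convex_approxPairs (hA : Convex ℝ A) : Convex ℝ (approxPairs K A M ε p) := by
  have h1 : Convex ℝ {c : Eucl d × Eucl d | c.1 ∈ Metric.cthickening ε A} :=
    (hA.cthickening ε).linear_preimage (LinearMap.fst ℝ (Eucl d) (Eucl d))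
  rintro c ⟨hc1, hc2, hc3⟩ c' ⟨hc1', hc2', hc3'⟩ s t hs ht hst
  refine ⟨h1 hc1 hc1' hs ht hst, ?_, fun w hw => ?_⟩
  · calc ‖s • c.2 + t • c'.2‖ ≤ ‖s • c.2‖ + ‖t • c'.2‖ := norm_add_le _ _
      _ = s * ‖c.2‖ + t * ‖c'.2‖ := by
        rw [norm_smul, norm_smul, Real.norm_of_nonneg hs, Real.norm_of_nonneg ht]
      _ ≤ s * M + t * M := by gcongr
      _ = M := by rw [← add_mul, hst, one_mul]
  · change inner ℝ (s • c.2 + t • c'.2) (w - p) ≤ ε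
    rw [inner_add_left, real_inner_smul_left, real_inner_smul_left]
    calc _ ≤ s * ε + t * ε := by
          gcongr
          · exact hc3 w hw
          · exact hc3' w hw
      _ = ε := by rw [← add_mul, hst, one_mul]

lemma isClosed_approxPairs : IsClosed (approxPairs K A M ε p) := by
  have h1 : IsClosed {c : Eucl d × Eucl d | c.1 ∈ Metric.cthickening ε A} :=
    Metric.isClosed_cthickening.preimage continuous_fst
  have h2 : IsClosed {c : Eucl d × Eucl d | ‖c.2‖ ≤ M} :=
    isClosed_le (by fun_prop) continuous_const
  have h3 : IsClosed {c : Eucl d × Eucl d | ∀ w ∈ K, inner ℝ c.2 (w - p) ≤ ε} := by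
    simp only [ofPred_forall]
    exact isClosed_biInter fun w _ => isClosed_le (by fun_prop) continuous_const
  exact h1.inter (h2.inter h3)

lemma isCompact_approxPairs (hA : IsCompact A) : IsCompact (approxPairs K A M ε p) := by
  refine ((hA.cthickening (r := ε)).prod (isCompact_closedBall (0 : Eucl d) M)).of_isClosed_subset
    isClosed_approxPairs ?_
  rintro c ⟨hc1, hc2, -⟩
  exact ⟨hc1, by simpa using hc2⟩

lemma approxPairs_mono {ε' : ℝ} (h : ε ≤ ε') :
    approxPairs K A M ε p ⊆ approxPairs K A M ε' p := fun _ hc =>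
  ⟨Metric.cthickening_mono h _ hc.1, hc.2.1, fun w hw => (hc.2.2 w hw).trans h⟩

/-- A vector that is a difference of an approximate pair for every tolerance is a difference of an
exact pair. -/
lemma exists_pair_of_forall_approxPairs (hA : IsCompact A) {v : Eucl d}
    (h : ∀ ε : ℝ, 0 < ε → ∃ c ∈ approxPairs K A M ε p, v = c.1 - c.2) :
    ∃ f ∈ A, ∃ q : Eucl d, (∀ w ∈ K, inner ℝ q (w - p) ≤ 0) ∧ v = f - q := by
  have h' : ∀ j : ℕ, ∃ c ∈ approxPairs K A M (1 / ((j : ℝ) + 1)) p, v = c.1 - c.2 :=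
    fun j => h _ (by positivity)
  choose c hc hv using h'
  have hanti : ∀ j : ℕ, 1 / ((j : ℝ) + 1) ≤ 1 := fun j => by
    rw [div_le_one (by positivity)]
    linarith [(Nat.cast_nonneg j : (0 : ℝ) ≤ j)]
  obtain ⟨c₀, -, φ, hφ, hlim⟩ := (isCompact_approxPairs (K := K) (M := M) (ε := 1) (p := p)
    hA).tendsto_subseq fun j => approxPairs_mono (hanti j) (hc j)
  have hmem : ∀ ε : ℝ, 0 < ε → c₀ ∈ approxPairs K A M ε p := fun ε hε => by
    refine isClosed_approxPairs.mem_of_tendsto hlim ?_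
    have h0 := (tendsto_one_div_add_atTop_nhds_zero_nat (𝕜 := ℝ)).comp hφ.tendsto_atTop
    filter_upwards [h0.eventually (gt_mem_nhds hε)] with j hj
    exact approxPairs_mono (le_of_lt hj) (hc _)
  refine ⟨c₀.1, ?_, c₀.2, fun w hw => le_of_forall_pos_le_add fun ε hε => ?_, ?_⟩
  · rw [← hA.isClosed.closure_eq, Metric.closure_eq_iInter_cthickening]
    exact mem_iInter₂.2 fun ε hε => (hmem ε hε).1
  · rw [zero_add]
    exact (hmem ε hε).2.2 w hw
  · have h1 : Tendsto (fun j => (c (φ j)).1 - (c (φ j)).2) atTop (𝓝 (c₀.1 - c₀.2)) :=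
      ((continuous_fst.sub continuous_snd).tendsto c₀).comp hlim
    simp only [← hv] at h1
    exact tendsto_nhds_unique tendsto_const_nhds h1

end

/-! ### Averaged velocities and limit trajectories -/

namespace NormalRecursion

variable {d : ℕ} {K : Set (Eucl d)} {F : Eucl d → Set (Eucl d)} {x g n E : ℕ → Eucl d}
  {γ : ℕ → ℝ} {M : ℝ} {N : ℕ}

lemma sub_eq (h : NormalRecursion K F x g n E γ M N) {i j : ℕ} (hi : N ≤ i) (hij : i ≤ j) :
    x j - x i = ∑ k ∈ Finset.Ioc i j, γ k • (g k - n k) + (E j - E i) := by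
  induction j, hij using Nat.le_induction with
  | base => simp
  | succ j hij ih =>
    rw [Finset.sum_Ioc_succ_top hij, ← sub_add_sub_cancel (x (j + 1)) (x j) (x i), ih,
      h.step j (hi.trans hij)]
    abel

lemma sum_Ioc_eq (γ : ℕ → ℝ) {i j : ℕ} (hij : i ≤ j) :
    ∑ k ∈ Finset.Ioc i j, γ k = elapsed γ j - elapsed γ i := by
  induction j, hij using Nat.le_induction with
  | base => simp
  | succ j hij ih =>
    rw [Finset.sum_Ioc_succ_top hij, ih, elapsed_succ]
    ring

/-- Field and normal parts contribute `M` each per unit time; the noise telescopes to the endpoints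
of `E`. -/
lemma dist_le (h : NormalRecursion K F x g n E γ M N) (hγ : StepAssumption γ) {i j : ℕ}
    (hi : N ≤ i) (hij : i ≤ j) :
    dist (x j) (x i) ≤ 2 * M * (elapsed γ j - elapsed γ i) + dist (E j) (E i) := by
  rw [dist_eq_norm, dist_eq_norm, h.sub_eq hi hij, ← sum_Ioc_eq γ hij, Finset.mul_sum]
  refine (norm_add_le _ _).trans (add_le_add (norm_sum_le_of_le _ fun k hk => ?_) le_rfl)
  have hk' := Finset.mem_Ioc.1 hk
  have hpos := (hγ.pos k (by omega)).le
  rw [norm_smul, Real.norm_of_nonneg hpos, mul_comm]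
  gcongr
  linarith [norm_sub_le (g k) (n k), h.norm_field k (by omega), h.norm_normal k (by omega)]

/-- If `x` stays close to `p` during some steps, then its average velocity over them is, up to the
summable noise, a difference of an approximate pair at `p`. -/
lemma exists_average (h : NormalRecursion K F x g n E γ M N) (hγ : StepAssumption γ)
    {p : Eucl d} (hp : p ∈ K) (hF : Convex ℝ (F p)) (hM : 0 ≤ M) {ε : ℝ} (hε : 0 < ε) :
    ∃ δ : ℝ, 0 < δ ∧ ∃ N' : ℕ, ∀ i j : ℕ, N' ≤ i → i < j →
      (∀ k, i < k → k ≤ j → dist (x k) p < δ) →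
      ∃ c ∈ approxPairs K (F p) M ε p,
        x j - x i = (elapsed γ j - elapsed γ i) • (c.1 - c.2) + (E j - E i) := by
  obtain ⟨δ, hδ, hev⟩ := h.field p hp ε hε
  obtain ⟨N', hN'⟩ := eventually_atTop.1 hev
  -- The second radius moves the base point of the normal inequality from `x k` to `p` at cost at
  -- most `ε`; `M + 1` keeps it positive when `M = 0`.
  refine ⟨min δ (ε / (M + 1)), lt_min hδ (by positivity), max N N', fun i j hi hij hd => ?_⟩
  have hiN : N ≤ i := (le_max_left _ _).trans hi
  have hpairs : ∀ k ∈ Finset.Ioc i j, (g k, n k) ∈ approxPairs K (F p) M ε p := fun k hk => by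
    have hk' := Finset.mem_Ioc.1 hk
    have hdk := hd k hk'.1 hk'.2
    refine ⟨hN' k (((le_max_right _ _).trans hi).trans hk'.1.le)
      (hdk.trans_le (min_le_left _ _)), h.norm_normal k (by omega), fun w hw => ?_⟩
    have h1 := h.normal k (by omega) w hw
    have h2 : inner ℝ (n k) (x k - p) ≤ ε := by
      refine (real_inner_le_norm _ _).trans ?_
      have h3 : ‖x k - p‖ ≤ ε / (M + 1) := by
        rw [← dist_eq_norm]
        exact (hdk.trans_le (min_le_right _ _)).le
      calc ‖n k‖ * ‖x k - p‖ ≤ (M + 1) * (ε / (M + 1)) := by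
            gcongr
            linarith [h.norm_normal k (by omega)]
        _ = ε := by field_simp
    calc inner ℝ (n k) (w - p) = inner ℝ (n k) (w - x k) + inner ℝ (n k) (x k - p) := by
          rw [← inner_add_right, sub_add_sub_cancel]
      _ ≤ ε := by linarith
  have hpos : 0 < ∑ k ∈ Finset.Ioc i j, γ k := by
    rw [sum_Ioc_eq γ hij.le]
    exact sub_pos.2 (hγ.elapsed_strictMono hij)
  refine ⟨_, (convex_approxPairs hF).centerMass_mem (fun k hk => (hγ.pos k ?_).le) hpos hpairs, ?_⟩
  · have := Finset.mem_Ioc.1 hk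
    omega
  · rw [h.sub_eq hiN hij.le, ← sum_Ioc_eq γ hij.le, Finset.centerMass]
    simp only [Prod.smul_fst, Prod.smul_snd, Prod.fst_sum, Prod.snd_sum, ← smul_sub,
      smul_inv_smul₀ hpos.ne', ← Finset.sum_sub_distrib]

end NormalRecursion

namespace NormalRecursion

variable {d : ℕ} {K : Set (Eucl d)} {F : Eucl d → Set (Eucl d)} {x g n E : ℕ → Eucl d}
  {γ : ℕ → ℝ} {M : ℝ} {N : ℕ}

/-- Shifted interpolations of the recursion converge along every nonprincipal ultrafilter to a
trajectory of the differential inclusion `z' ∈ F z - N_K z`. Here `m j t` is the index reached at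
time `t` when starting from index `j`. -/
lemma exists_limit_trajectory (h : NormalRecursion K F x g n E γ M N) (hγ : StepAssumption γ)
    (hK : IsCompact K) (hFconv : ∀ p ∈ K, Convex ℝ (F p)) (hFcomp : ∀ p ∈ K, IsCompact (F p))
    (hM : 0 ≤ M) (𝒱 : Ultrafilter ℕ) (h𝒱 : ↑𝒱 ≤ (atTop : Filter ℕ)) :
    ∃ (m : ℕ → ℝ → ℕ) (z : ℝ → Eucl d), (∀ j t, j ≤ m j t) ∧
      (∀ j t, 0 ≤ t → elapsed γ j + t < elapsed γ (m j t + 1)) ∧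
      (∀ j t, 0 ≤ t → elapsed γ (m j t) ≤ elapsed γ j + t) ∧
      (∀ t, Tendsto (fun j => x (m j t)) 𝒱 (𝓝 (z t))) ∧
      Tendsto x 𝒱 (𝓝 (z 0)) ∧
      (∀ t, z t ∈ K) ∧
      LipschitzWith (2 * M).toNNReal z ∧
      ∀ t, 0 < t → ∀ v, HasDerivAt z v t →
        ∃ f ∈ F (z t), ∃ q : Eucl d, (∀ w ∈ K, inner ℝ q (w - z t) ≤ 0) ∧ v = f - q := by
  have hmono := hγ.elapsed_strictMono
  have hid : Tendsto (fun j : ℕ => j) 𝒱 atTop := h𝒱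
  -- Truncating at `max t 0` defines the curve for all real times, constant for `t ≤ 0`.
  choose m hjm hle hlt using fun (j : ℕ) (t : ℝ) =>
    hγ.exists_index (j := j) (s := elapsed γ j + max t 0) (by linarith [le_max_right t 0])
  have hm_top : ∀ t, Tendsto (fun j => m j t) 𝒱 atTop := fun t =>
    tendsto_atTop_mono (fun j => hjm j t) hid
  have hm_mono : ∀ j t t', t ≤ t' → m j t ≤ m j t' := fun j t t' htt => by
    have h1 : elapsed γ (m j t) < elapsed γ (m j t' + 1) :=
      (hle j t).trans_lt (lt_of_le_of_lt (by gcongr) (hlt j t'))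
    have := hmono.lt_iff_lt.1 h1
    omega
  have hgap : ∀ t, Tendsto (fun j => elapsed γ (m j t) - elapsed γ j) 𝒱 (𝓝 (max t 0)) := by
    intro t
    have h1 : Tendsto (fun j => max t 0 - γ (m j t + 1)) 𝒱 (𝓝 (max t 0)) := by
      have := (hγ.tendsto_zero.comp (tendsto_add_atTop_nat 1)).comp (hm_top t)
      simpa using this.const_sub (max t 0)
    refine tendsto_of_tendsto_of_tendsto_of_le_of_le h1 tendsto_const_nhds (fun j => ?_)
      fun j => ?_
    · have := hlt j t
      rw [elapsed_succ] at this
      simp only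
      linarith
    · simp only
      linarith [hle j t]
  have hgap2 : ∀ t t', Tendsto (fun j => elapsed γ (m j t') - elapsed γ (m j t)) 𝒱
      (𝓝 (max t' 0 - max t 0)) := fun t t' => by
    simpa using (hgap t').sub (hgap t)
  obtain ⟨s, hs⟩ := h.converges
  have hE : ∀ t t', Tendsto (fun j => E (m j t') - E (m j t)) 𝒱 (𝓝 0) := fun t t' => by
    simpa using (hs.comp (hm_top t')).sub (hs.comp (hm_top t))
  have hlarge : ∀ i : ℕ, ∀ᶠ j in (𝒱 : Filter ℕ), i ≤ j := fun i =>
    hid.eventually (eventually_ge_atTop i)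
  -- One ultrafilter gives limits at all times simultaneously, replacing an Arzelà–Ascoli
  -- extraction.
  have hlim : ∀ t, ∃ p ∈ K, Tendsto (fun j => x (m j t)) 𝒱 (𝓝 p) := fun t => by
    have hev : ∀ᶠ j in (𝒱 : Filter ℕ), x (m j t) ∈ K :=
      (hlarge N).mono fun j hj => h.mem _ (hj.trans (hjm j t))
    exact hK.ultrafilter_le_nhds (𝒱.map fun j => x (m j t)) (le_principal_iff.2 hev)
  choose z hzK hz using hlim
  have hlip : ∀ t t', t ≤ t' → dist (z t') (z t) ≤ 2 * M * (t' - t) := fun t t' htt => by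
    have h1 : Tendsto (fun j => 2 * M * (elapsed γ (m j t') - elapsed γ (m j t)) +
        dist (E (m j t')) (E (m j t))) 𝒱 (𝓝 (2 * M * (max t' 0 - max t 0) + 0)) := by
      refine ((hgap2 t t').const_mul _).add ?_
      simpa [dist_eq_norm] using (hE t t').norm
    have h2 : dist (z t') (z t) ≤ 2 * M * (max t' 0 - max t 0) + 0 := by
      refine le_of_tendsto_of_tendsto ((hz t').dist (hz t)) h1 ?_
      filter_upwards [hlarge N] with j hj
      exact h.dist_le hγ (hj.trans (hjm j t)) (hm_mono j t t' htt)
    have h3 : max t' 0 - max t 0 ≤ t' - t := by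
      rcases max_cases t' 0 with h | h <;> rcases max_cases t 0 with h' | h' <;> linarith
    calc _ ≤ _ := h2
      _ ≤ 2 * M * (t' - t) := by
        rw [add_zero]
        gcongr
  have hm0 : ∀ j, m j 0 = j := fun j => by
    have h1 : elapsed γ (m j 0) ≤ elapsed γ j := by simpa using hle j 0
    exact le_antisymm (hmono.le_iff_le.1 h1) (hjm j 0)
  refine ⟨m, z, hjm, fun j t ht => by simpa [max_eq_left ht] using hlt j t,
    fun j t ht => by simpa [max_eq_left ht] using hle j t, hz, by simpa [hm0] using hz 0, hzK,
    LipschitzWith.of_dist_le_mul fun t t' => ?_, fun t ht v hv => ?_⟩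
  · rw [Real.coe_toNNReal _ (by positivity), Real.dist_eq]
    rcases le_total t t' with htt | htt
    · rw [dist_comm, abs_of_nonpos (by linarith)]
      linarith [hlip t t' htt]
    · rw [abs_of_nonneg (by linarith)]
      exact hlip t' t htt
  · refine exists_pair_of_forall_approxPairs (M := M) (hFcomp _ (hzK t)) fun ε hε => ?_
    obtain ⟨δ, hδ, N', hN'⟩ := h.exists_average hγ (hzK t) (hFconv _ (hzK t)) hM hε
    have hcompact := isCompact_approxPairs (K := K) (M := M) (ε := ε) (p := z t)
      (hFcomp _ (hzK t))
    have key : ∀ᶠ s in 𝓝[>] (0 : ℝ), s⁻¹ • (z (t + s) - z t) ∈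
        (fun c : Eucl d × Eucl d => c.1 - c.2) '' approxPairs K (F (z t)) M ε (z t) := by
      have hcont : Tendsto (fun s : ℝ => 2 * M * s) (𝓝[>] 0) (𝓝 0) := by
        have : Tendsto (fun s : ℝ => 2 * M * s) (𝓝 0) (𝓝 (2 * M * 0)) :=
          (continuous_const_mul (2 * M)).tendsto 0
        rw [mul_zero] at this
        exact this.mono_left nhdsWithin_le_nhds
      filter_upwards [hcont.eventually (gt_mem_nhds (show 0 < δ / 4 by positivity)),
        self_mem_nhdsWithin] with s hs1 hs2
      have hs0 : 0 < s := hs2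
      have hg : Tendsto (fun j => elapsed γ (m j (t + s)) - elapsed γ (m j t)) 𝒱 (𝓝 s) := by
        have := hgap2 t (t + s)
        rwa [max_eq_left (by linarith), max_eq_left ht.le, add_sub_cancel_left] at this
      have hev : ∀ᶠ j in (𝒱 : Filter ℕ), ∃ c ∈ approxPairs K (F (z t)) M ε (z t),
          x (m j (t + s)) - x (m j t) = (elapsed γ (m j (t + s)) - elapsed γ (m j t)) •
            (c.1 - c.2) + (E (m j (t + s)) - E (m j t)) := by
        -- Drift, noise and initial distance each take `δ / 4`, keeping the iterates in the window
        -- within `δ` of `z t`.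
        obtain ⟨N₁, hN₁⟩ := Metric.cauchySeq_iff.1 hs.cauchySeq (δ / 4) (by positivity)
        filter_upwards [hlarge N, hlarge N', hlarge N₁,
          (hz t).eventually (Metric.ball_mem_nhds _ (show 0 < δ / 4 by positivity)),
          hg.eventually (lt_mem_nhds hs0),
          (hg.const_mul (2 * M)).eventually (gt_mem_nhds hs1)] with j hj hj' hj₁ hx hpos hsmall
        refine hN' _ _ (hj'.trans (hjm j t)) (hmono.lt_iff_lt.1 (sub_pos.1 hpos))
          fun k hk1 hk2 => ?_
        have h1 := h.dist_le hγ (hj.trans (hjm j t)) hk1.le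
        have h2 := hN₁ k (by have := hjm j t; omega) (m j t) (hj₁.trans (hjm j t))
        have h3 : 2 * M * (elapsed γ k - elapsed γ (m j t)) ≤
            2 * M * (elapsed γ (m j (t + s)) - elapsed γ (m j t)) := by
          gcongr
          exact hmono.monotone hk2
        have h4 : dist (x (m j t)) (z t) < δ / 4 := hx
        linarith [dist_triangle (x k) (x (m j t)) (z t)]
      obtain ⟨c, hc⟩ := hev.choice
      obtain ⟨c₀, hc₀, hcc⟩ := hcompact.ultrafilter_le_nhds (𝒱.map c)
        (le_principal_iff.2 (hc.mono fun j hj => hj.1))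
      have hcc' : Tendsto c 𝒱 (𝓝 c₀) := hcc
      have h1 : Tendsto (fun j => (elapsed γ (m j (t + s)) - elapsed γ (m j t)) •
            ((c j).1 - (c j).2) + (E (m j (t + s)) - E (m j t))) 𝒱
            (𝓝 (s • (c₀.1 - c₀.2) + 0)) :=
        (hg.smul (((continuous_fst.sub continuous_snd).tendsto c₀).comp hcc')).add (hE _ _)
      have h2 := tendsto_nhds_unique (h1.congr' (hc.mono fun j hj => hj.2.symm))
        ((hz (t + s)).sub (hz t))
      refine ⟨c₀, hc₀, ?_⟩
      rw [← h2, add_zero, inv_smul_smul₀ hs0.ne']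
    have hclosed : IsClosed ((fun c : Eucl d × Eucl d => c.1 - c.2) ''
        approxPairs K (F (z t)) M ε (z t)) :=
      (hcompact.image (by fun_prop)).isClosed
    obtain ⟨c, hc, hcv⟩ := hclosed.mem_of_tendsto hv.tendsto_slope_zero_right key
    exact ⟨c, hc, hcv.symm⟩

end NormalRecursion

/-! ### Velocities of limit trajectories and descent of `V` -/

section
variable {d : ℕ} {X K : Set (Eucl d)} {F : Eucl d → Set (Eucl d)}

/-- The velocity of a viable trajectory of `z' ∈ F z - N_K z` lies in the projected field. -/
lemma mem_projField_of_hasDerivAt {z : ℝ → Eucl d} {t : ℝ} {v f q : Eucl d} (hzK : ∀ s, z s ∈ K)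
    (hz : HasDerivAt z v t) (hf : f ∈ F (z t)) (hq : ∀ w ∈ K, inner ℝ q (w - z t) ≤ 0)
    (hv : v = f - q) : v ∈ projField K F (z t) := by
  have htangent : ∀ s : ℝ, 0 < s → ∀ w ∈ K,
      s⁻¹ • (w - z t) ∈ {v | ∃ ε : ℝ, 0 < ε ∧ z t + ε • v ∈ K} := fun s hs w hw =>
    ⟨s, hs, by rwa [smul_inv_smul₀ hs.ne', add_sub_cancel]⟩
  have hq' : ∀ u ∈ convexTangentCone K (z t), inner ℝ q u ≤ 0 := by
    have hcl : IsClosed {u : Eucl d | inner ℝ q u ≤ 0} :=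
      isClosed_le (by fun_prop) continuous_const
    refine fun u hu => closure_minimal ?_ hcl hu
    rintro u ⟨ε, hε, hu⟩
    have h1 := hq _ hu
    rw [add_sub_cancel_left, real_inner_smul_right] at h1
    exact nonpos_of_mul_nonpos_right h1 hε
  have hv1 : v ∈ convexTangentCone K (z t) := by
    refine mem_closure_of_tendsto hz.tendsto_slope_zero_right ?_
    filter_upwards [self_mem_nhdsWithin] with s hs
    exact htangent s hs _ (hzK _)
  -- Time reversal about `t`: the curve lies in `K` on both sides.
  have hv2 : -v ∈ convexTangentCone K (z t) := by
    have h1 : HasDerivAt (fun s => z (2 * t - s)) (-v) t := by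
      have h2 : HasDerivAt z v (2 * t - t) := by rwa [two_mul, add_sub_cancel_right]
      simpa using h2.comp_const_sub (2 * t) t
    have h3 := h1.tendsto_slope_zero_right
    rw [show 2 * t - t = t by ring] at h3
    refine mem_closure_of_tendsto h3 ?_
    filter_upwards [self_mem_nhdsWithin] with s hs
    exact htangent s hs _ (hzK _)
  have hqv : inner ℝ q v = 0 := by
    have h1 := hq' _ hv2
    rw [inner_neg_right] at h1
    linarith [hq' _ hv1]
  refine ⟨hv1, f, hf, fun u hu => ?_⟩
  -- `‖f - u‖² = ‖q‖² + 2⟪q, v - u⟫ + ‖v - u‖² ≥ ‖q‖²`, since `⟪q, v⟫ = 0` and `⟪q, u⟫ ≤ 0`.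
  rw [dist_eq_norm, dist_eq_norm, show f - v = q by rw [hv]; abel]
  by_contra! hlt
  have h1 : f - u = q + (v - u) := by rw [hv]; abel
  have h2 := norm_add_sq_real q (v - u)
  rw [← h1, inner_sub_right, hqv] at h2
  nlinarith [hq' u hu, norm_nonneg (f - u), sq_nonneg ‖v - u‖, norm_nonneg q]

/-- The local Lipschitz bound makes replacing `z (t + s)` by `z t + s • v` cost only `o(s)` in `V`;
regularity identifies the resulting directional derivative. -/
lemma clarkeDeriv_eq_of_hasDerivAt {V : Eucl d → ℝ} (hX : IsOpen X) (hV : LocallyLipschitzOn X V)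
    {z : ℝ → Eucl d} {t : ℝ} {v : Eucl d} {D : ℝ} (hzX : z t ∈ X)
    (hreg : ClarkeRegularAt V (z t)) (hz : HasDerivAt z v t)
    (hD : HasDerivAt (fun s => V (z s)) D t) : clarkeDeriv V (z t) v = D := by
  obtain ⟨C, W, hW, hC⟩ := hV hzX
  rw [hX.nhdsWithin_eq hzX] at hW
  have h1 := hreg v
  have h2 := hD.tendsto_slope_zero_right
  have h3 := hz.tendsto_slope_zero_right
  have hw1 : ∀ᶠ s in 𝓝[>] (0 : ℝ), z (t + s) ∈ W := by
    have : Tendsto (fun s : ℝ => z (t + s)) (𝓝 0) (𝓝 (z t)) := by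
      have h4 : ContinuousAt (fun s : ℝ => z (t + s)) 0 := by
        refine ContinuousAt.comp (g := z) ?_ (by fun_prop)
        simpa using hz.continuousAt
      simpa [ContinuousAt] using h4
    exact (this.eventually hW).filter_mono nhdsWithin_le_nhds
  have hw2 : ∀ᶠ s in 𝓝[>] (0 : ℝ), z t + s • v ∈ W := by
    have : Tendsto (fun s : ℝ => z t + s • v) (𝓝 0) (𝓝 (z t + (0 : ℝ) • v)) :=
      Continuous.tendsto (by fun_prop) 0
    rw [zero_smul, add_zero] at this
    exact (this.eventually hW).filter_mono nhdsWithin_le_nhds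
  have h5 : Tendsto (fun s : ℝ => (C : ℝ) * ‖s⁻¹ • (z (t + s) - z t) - v‖) (𝓝[>] 0) (𝓝 0) := by
    have := ((h3.sub_const v).norm).const_mul (C : ℝ)
    simpa using this
  have h6 : Tendsto (fun s : ℝ => s⁻¹ • (V (z (t + s)) - V (z t)) -
      (V (z t + s • v) - V (z t)) / s) (𝓝[>] 0) (𝓝 0) := by
    refine squeeze_zero_norm' ?_ h5
    filter_upwards [hw1, hw2, self_mem_nhdsWithin] with s hs1 hs2 hs
    have hs0 : 0 < s := hs
    have h7 := hC.dist_le_mul _ hs1 _ hs2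
    rw [Real.dist_eq, dist_eq_norm] at h7
    have h8 : s⁻¹ • (V (z (t + s)) - V (z t)) - (V (z t + s • v) - V (z t)) / s =
        s⁻¹ * (V (z (t + s)) - V (z t + s • v)) := by
      rw [smul_eq_mul]
      field_simp
      ring
    have h9 : s⁻¹ • (z (t + s) - z t) - v = s⁻¹ • (z (t + s) - (z t + s • v)) := by
      rw [← sub_sub, smul_sub _ _ (s • v), inv_smul_smul₀ hs0.ne']
    rw [h8, h9, norm_mul, norm_smul, Real.norm_of_nonneg (inv_nonneg.2 hs0.le), Real.norm_eq_abs,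
      mul_left_comm]
    gcongr
  have h7 := h2.sub h1
  have h8 := tendsto_nhds_unique h7 h6
  linarith

/-- The forward curve gives `⟪v, w⟫ ≤ D` and the time-reversed one `⟪-v, w⟫ ≤ -D`, so the pairing is
the same for every generalized gradient `w`. -/
lemma mem_lieDeriv_of_hasDerivAt {V : Eucl d → ℝ} (hX : IsOpen X) (hV : LocallyLipschitzOn X V)
    {G : Eucl d → Set (Eucl d)} {z : ℝ → Eucl d} {t : ℝ} {v : Eucl d} {D : ℝ} (hzX : z t ∈ X)
    (hreg : ClarkeRegularAt V (z t)) (hz : HasDerivAt z v t)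
    (hD : HasDerivAt (fun s => V (z s)) D t) (hv : v ∈ G (z t)) : D ∈ lieDeriv G V (z t) := by
  refine ⟨v, hv, fun w hw => le_antisymm ?_ ?_⟩
  · exact (hw v).trans_eq (clarkeDeriv_eq_of_hasDerivAt hX hV hzX hreg hz hD)
  · have ht : 2 * t - t = t := by ring
    have h1 : HasDerivAt (fun s => z (2 * t - s)) (-v) t := by
      simpa using HasDerivAt.comp_const_sub (2 * t) t (by rwa [ht])
    have h2 : HasDerivAt (fun s => V (z (2 * t - s))) (-D) t := by
      simpa using HasDerivAt.comp_const_sub (f := fun s => V (z s)) (2 * t) t (by rwa [ht])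
    have h3 := clarkeDeriv_eq_of_hasDerivAt (z := fun s => z (2 * t - s)) hX hV (by rwa [ht])
      (by rwa [ht]) h1 h2
    rw [ht] at h3
    have h4 := hw (-v)
    rw [h3, inner_neg_left] at h4
    linarith

/-- A trajectory along which the derivative of `V` is at most `U` almost everywhere strictly
decreases `V` right after leaving a point where `U` is negative. -/
lemma eventually_lt_of_ae_deriv_le {V U : Eucl d → ℝ} (hX : IsOpen X) (hKX : K ⊆ X)
    (hV : LocallyLipschitzOn X V) (hU : UpperSemicontinuousOn U X) {C : NNReal}
    {z : ℝ → Eucl d} (hzK : ∀ s, z s ∈ K) (hz : LipschitzWith C z)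
    (hder : ∀ t, 0 < t → DifferentiableAt ℝ z t → ∀ D, HasDerivAt (fun s => V (z s)) D t →
      D ≤ U (z t)) (h0 : U (z 0) < 0) :
    ∀ᶠ t in 𝓝[>] (0 : ℝ), V (z t) < V (z 0) := by
  have hzX : z 0 ∈ X := hKX (hzK 0)
  obtain ⟨C', W, hW, hC'⟩ := hV hzX
  -- Upper semicontinuity gives a constant negative bound to integrate, so no integrability of `U ∘
  -- z` is required.
  have hUW := hU (z 0) hzX (U (z 0) / 2) (by linarith)
  rw [hX.nhdsWithin_eq hzX] at hW hUW
  have hW' : ∀ᶠ p in 𝓝 (z 0), p ∈ W := hW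
  have hWz : ∀ᶠ t in 𝓝 (0 : ℝ), z t ∈ W ∧ U (z t) < U (z 0) / 2 :=
    hz.continuous.continuousAt.eventually (hW'.and hUW)
  obtain ⟨h, hh, hball⟩ := Metric.eventually_nhds_iff_ball.1 hWz
  filter_upwards [Ioo_mem_nhdsGT hh] with t ht
  have hIcc : ∀ s ∈ Icc 0 t, z s ∈ W ∧ U (z s) < U (z 0) / 2 := fun s hs => by
    refine hball s ?_
    rw [Metric.mem_ball, Real.dist_eq, sub_zero, abs_of_nonneg hs.1]
    exact hs.2.trans_lt ht.2
  have hlip : LipschitzOnWith (C' * C) (fun s => V (z s)) (uIcc 0 t) := by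
    rw [uIcc_of_le ht.1.le]
    exact hC'.comp hz.lipschitzOnWith fun s hs => (hIcc s hs).1
  have hac := hlip.absolutelyContinuousOnInterval
  have hle : ∫ s in (0 : ℝ)..t, deriv (fun s => V (z s)) s ≤ ∫ _ in (0 : ℝ)..t, U (z 0) / 2 := by
    refine intervalIntegral.integral_mono_ae_restrict ht.1.le hac.intervalIntegrable_deriv
      intervalIntegrable_const ?_
    refine (MeasureTheory.ae_restrict_iff' measurableSet_Icc).2 ?_
    filter_upwards [hz.ae_differentiableAt (μ := MeasureTheory.volume), hac.ae_differentiableAt,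
      MeasureTheory.Measure.ae_ne MeasureTheory.volume (0 : ℝ)] with s hs1 hs2 hs3 hs
    have hs2' := hs2 (by rwa [uIcc_of_le ht.1.le])
    exact (hder s (lt_of_le_of_ne hs.1 hs3.symm) hs1 _ hs2'.hasDerivAt).trans (hIcc s hs).2.le
  rw [hac.integral_deriv_eq_sub, intervalIntegral.integral_const, smul_eq_mul] at hle
  have : (t - 0) * (U (z 0) / 2) < 0 := mul_neg_of_pos_of_neg (by linarith [ht.1]) (by linarith)
  linarith

end

/-! ### From the discretization to the recursion; limit points and upcrossings -/

section
variable {d : ℕ} {X K : Set (Eucl d)} {F : Eucl d → Set (Eucl d)}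
  {x y : ℕ → Eucl d} {γ : ℕ → ℝ} {η e r : ℕ → Eucl d}

lemma inner_sub_nonpos_of_forall_dist_le (hK : Convex ℝ K) {a p : Eucl d} (hp : p ∈ K)
    (hmin : ∀ z ∈ K, dist a p ≤ dist a z) : ∀ w ∈ K, inner ℝ (a - p) (w - p) ≤ 0 := by
  refine (norm_eq_iInf_iff_real_inner_le_zero hK hp).1 (le_antisymm ?_ ?_)
  · have : Nonempty K := ⟨⟨p, hp⟩⟩
    exact le_ciInf fun w => by simpa [dist_eq_norm] using hmin w w.2
  · exact ciInf_le (f := fun w : K => ‖a - w‖)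
      ⟨0, by rintro _ ⟨w, rfl⟩; exact norm_nonneg _⟩ ⟨p, hp⟩

lemma IsPPAD.exists_normalRecursion (hK_convex : Convex ℝ K) (hK_compact : IsCompact K)
    (hKX : K ⊆ X) (hF : FieldAssumption X F) (hγ : StepAssumption γ)
    (hη : NoiseAssumption γ η e r) (hy : ApproxAssumption X x y) (hx : IsPPAD X K F x y γ η)
    (he : ∃ C : ℝ, ∀ k, 1 ≤ k → ‖e k‖ ≤ C) :
    ∃ (g n E : ℕ → Eucl d) (M : ℝ) (N : ℕ), 0 ≤ M ∧ NormalRecursion K F x g n E γ M N := by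
  obtain ⟨C, hC⟩ := he
  have hC0 : 0 ≤ C := (norm_nonneg _).trans (hC 1 le_rfl)
  -- The points `y k` need not lie in `K`, only eventually near it, so `F` is bounded on a compact
  -- thickening inside `X`.
  obtain ⟨δ₀, hδ₀, hthick⟩ := hK_compact.exists_cthickening_subset_open hF.isOpen hKX
  obtain ⟨B, hB0, hB⟩ := (hF.locallyBounded _ (hK_compact.cthickening (r := δ₀))
    hthick).exists_pos_norm_le
  choose hmem w hw hmin using hx.step
  choose v hv hvw using hw
  have hxK : ∀ k, 1 ≤ k → x k ∈ K := fun k hk => by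
    obtain ⟨k, rfl⟩ := Nat.exists_eq_succ_of_ne_zero (by omega : k ≠ 0)
    exact hmem k
  have hev : ∀ᶠ k in atTop, 1 ≤ k ∧ ‖r k‖ < 1 ∧ ‖x k - y k‖ < δ₀ :=
    (eventually_ge_atTop 1).and ((hη.tendsto_zero.eventually (gt_mem_nhds one_pos)).and
      (hy.tendsto_zero.eventually (gt_mem_nhds hδ₀)))
  obtain ⟨N, hN⟩ := eventually_atTop.1 hev
  have hvB : ∀ k, N ≤ k → ‖v k‖ ≤ B := fun k hk => by
    obtain ⟨h1, -, h2⟩ := hN (k + 1) (by omega)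
    refine hB _ (mem_iUnion₂.2 ⟨y (k + 1), ?_, hv k⟩)
    refine Metric.mem_cthickening_of_dist_le _ (x (k + 1)) _ _ (hmem k) ?_
    rw [dist_comm, dist_eq_norm]
    exact h2.le
  -- `v k` is chosen for the step to `k + 1`, hence the shift. `r` joins the field, `e` goes into
  -- `E`, and `n` is the projection defect over `γ`; the bound adds those of `F`, `r` and `e`.
  refine ⟨fun k => v (k - 1) + r k,
    fun k => (γ k)⁻¹ • (x (k - 1) + γ k • (v (k - 1) + η k) - x k),
    fun n => ∑ k ∈ Finset.Icc 1 n, γ k • e k, B + 1 + C, N, by positivity, ?_⟩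
  have hstep : ∀ k, x k + γ (k + 1) • (v k + η (k + 1)) = w k := fun k => hvw k
  constructor
  · exact fun k hk => hxK k (hN k hk).1
  · intro k _
    simp only [add_tsub_cancel_right]
    rw [Finset.sum_Icc_succ_top (by omega), add_sub_cancel_left, smul_sub,
      smul_inv_smul₀ (hγ.pos (k + 1) (by omega)).ne', hη.decomp (k + 1) (by omega)]
    simp only [smul_add]
    abel
  · intro k hk
    have h1 := hvB (k - 1) (by omega)
    have h2 := (hN k hk.le).2.1
    linarith [norm_add_le (v (k - 1)) (r k)]
  · intro k hk
    obtain ⟨k, rfl⟩ := Nat.exists_eq_succ_of_ne_zero (by omega : k ≠ 0)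
    have hpos := hγ.pos (k + 1) (by omega)
    have h1 := hvB k (by omega)
    have h2 := (hN (k + 1) hk.le).2.1
    have h3 := hC (k + 1) (by omega)
    -- The previous iterate competes in the projection; this needs an index at least 1, since `x 0`
    -- may lie outside `K`.
    have h4 := hmin k (x k) (hxK k (hN k (by omega)).1)
    rw [← hstep, dist_eq_norm, dist_eq_norm, add_sub_cancel_left, norm_smul,
      Real.norm_of_nonneg hpos.le] at h4
    have h5 : ‖v k + η (k + 1)‖ ≤ B + 1 + C := by
      rw [hη.decomp (k + 1) (by omega)]
      linarith [norm_add_le (v k) (e (k + 1) + r (k + 1)), norm_add_le (e (k + 1)) (r (k + 1))]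
    simp only [Nat.succ_eq_add_one, add_tsub_cancel_right]
    rw [norm_smul, norm_inv, Real.norm_of_nonneg hpos.le, inv_mul_le_iff₀ hpos]
    exact h4.trans (by gcongr)
  · intro k hk u hu
    obtain ⟨k, rfl⟩ := Nat.exists_eq_succ_of_ne_zero (by omega : k ≠ 0)
    simp only [Nat.succ_eq_add_one, add_tsub_cancel_right]
    rw [hstep, real_inner_smul_left]
    exact mul_nonpos_of_nonneg_of_nonpos (inv_nonneg.2 (hγ.pos (k + 1) (by omega)).le)
      (inner_sub_nonpos_of_forall_dist_le hK_convex (hmem k) (hmin k) u hu)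
  · intro p hp ε hε
    have h1 := upperHemicontinuousOn_iff_forall_isOpen.1 hF.upperHemicontinuousOn p (hKX hp)
      (Metric.thickening (ε / 2) (F p)) Metric.isOpen_thickening
      (Metric.self_subset_thickening (by positivity) _)
    rw [hF.isOpen.nhdsWithin_eq (hKX hp)] at h1
    obtain ⟨δ, hδ, hball⟩ := Metric.eventually_nhds_iff_ball.1 h1
    refine ⟨δ / 2, by positivity, ?_⟩
    filter_upwards [eventually_ge_atTop 1,
      hη.tendsto_zero.eventually (gt_mem_nhds (show 0 < ε / 2 by positivity)),
      hy.tendsto_zero.eventually (gt_mem_nhds (show 0 < δ / 2 by positivity))] with k hk hr hxy hd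
    obtain ⟨k, rfl⟩ := Nat.exists_eq_succ_of_ne_zero (by omega : k ≠ 0)
    have h2 : y (k + 1) ∈ Metric.ball p δ := by
      rw [← dist_eq_norm, dist_comm] at hxy
      exact (dist_triangle _ _ _).trans_lt (by simpa using add_lt_add hxy hd)
    obtain ⟨a, ha, hva⟩ := Metric.mem_thickening_iff.1 (hball _ h2 (hv k))
    refine Metric.mem_cthickening_of_dist_le _ a _ _ ha ?_
    have h3 : dist (v k + r (k + 1)) (v k) = ‖r (k + 1)‖ := by simp [dist_eq_norm]
    simp only [Nat.succ_eq_add_one, add_tsub_cancel_right] at hr ⊢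
    linarith [dist_triangle (v k + r (k + 1)) (v k) a]
  · exact hη.series_converges

lemma mem_limitPoints_iff {p : Eucl d} : p ∈ limitPoints x ↔ MapClusterPt p atTop x := by
  constructor
  · rintro ⟨φ, hφ, hlim⟩
    exact MapClusterPt.of_comp hφ.tendsto_atTop hlim.mapClusterPt
  · intro h
    obtain ⟨φ, hφ, hlim⟩ := h.tendsto_subseq
    exact ⟨φ, hφ, hlim⟩

lemma mem_limitPoints_of_tendsto {ι : Type*} {l : Filter ι} [l.NeBot] {u : ι → ℕ}
    (hu : Tendsto u l atTop) {p : Eucl d} (hp : Tendsto (fun i => x (u i)) l (𝓝 p)) :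
    p ∈ limitPoints x :=
  mem_limitPoints_iff.2 (MapClusterPt.of_comp hu hp.mapClusterPt)

lemma isCompact_limitPoints (hK : IsCompact K) (hx : ∀ᶠ k in atTop, x k ∈ K) :
    IsCompact (limitPoints x) ∧ limitPoints x ⊆ K ∧ (limitPoints x).Nonempty := by
  have hsub : limitPoints x ⊆ K := fun p ⟨φ, hφ, hlim⟩ =>
    hK.isClosed.mem_of_tendsto hlim (hφ.tendsto_atTop.eventually hx)
  have hclosed : IsClosed (limitPoints x) := by
    have : limitPoints x = {p | ClusterPt p (map x atTop)} := by
      ext p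
      exact mem_limitPoints_iff
    rw [this]
    exact isClosed_setOfPred_clusterPt
  refine ⟨hK.of_isClosed_subset hclosed hsub, hsub, ?_⟩
  obtain ⟨p, -, hp⟩ := hK (f := map x atTop) (le_principal_iff.2 hx)
  exact ⟨p, mem_limitPoints_iff.2 hp⟩

/-- A sequence that is infinitely often below `c` and infinitely often above `c'` has, infinitely
often, a last index below `c` before exceeding `c'`. -/
lemma frequently_upcrossing {a : ℕ → ℝ} {c c' : ℝ} (hc : c < c')
    (hlow : ∃ᶠ k in atTop, a k < c) (hhigh : ∃ᶠ k in atTop, c' < a k) :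
    ∃ᶠ j in atTop, a j ≤ c ∧ ∃ k, j < k ∧ c' < a k ∧ ∀ i, j < i → i ≤ k → c < a i := by
  classical
  refine frequently_atTop.2 fun N => ?_
  obtain ⟨j₀, hj₀, hlow⟩ := frequently_atTop.1 hlow N
  obtain ⟨k, hk, hhigh⟩ := frequently_atTop.1 hhigh j₀
  have h1 := Nat.findGreatest_spec (P := fun j => a j ≤ c) hk hlow.le
  have h2 := Nat.le_findGreatest (P := fun j => a j ≤ c) hk hlow.le
  have h3 := Nat.findGreatest_le (P := fun j => a j ≤ c) k
  refine ⟨_, hj₀.trans h2, h1, k, lt_of_le_of_ne h3 fun heq => ?_, hhigh, fun i hi hik => ?_⟩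
  · rw [heq] at h1
    linarith
  · exact not_le.1 (Nat.findGreatest_is_greatest hi hik)

end

/-! ### Lyapunov argument on the limit points -/

section
variable {d : ℕ} {X K : Set (Eucl d)} {F : Eucl d → Set (Eucl d)} {x g n E : ℕ → Eucl d}
  {γ : ℕ → ℝ} {M : ℝ} {N : ℕ} {V U : Eucl d → ℝ}

/-- A field `F` with a function `V` that does not increase, up to `U ≤ 0`, along the field projected
onto `K`. -/
structure ProjectedLyapunov (X K : Set (Eucl d)) (F : Eucl d → Set (Eucl d))
    (V U : Eucl d → ℝ) : Prop where
  isCompact : IsCompact K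
  subset : K ⊆ X
  field : FieldAssumption X F
  lipschitz : LocallyLipschitzOn X V
  regular : ∀ z ∈ X, ClarkeRegularAt V z
  upperSemicontinuous : UpperSemicontinuousOn U X
  lie_le : ∀ z ∈ K, ∀ a ∈ lieDeriv (projField K F) V z, a ≤ U z
  nonpos : ∀ z ∈ K, U z ≤ 0

namespace ProjectedLyapunov

/-- With `U ≤ 0` on `K`, the zero set is the superlevel set `0 ≤ U`, closed in `K` by upper
semicontinuity. -/
lemma isCompact_zeros (hL : ProjectedLyapunov X K F V U) : IsCompact {p | p ∈ K ∧ U p = 0} := by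
  obtain ⟨v, hv, heq⟩ := upperSemicontinuousOn_iff_preimage_Ici.1
    (hL.upperSemicontinuous.mono hL.subset) 0
  have : {p | p ∈ K ∧ U p = 0} = K ∩ v := by
    rw [← heq]
    ext p
    exact ⟨fun h => ⟨h.1, h.2.ge⟩, fun h => ⟨h.1, (hL.nonpos p h.1).antisymm h.2⟩⟩
  rw [this]
  exact hL.isCompact.inter_right hv

lemma continuousAt (hL : ProjectedLyapunov X K F V U) {p : Eucl d} (hp : p ∈ K) :
    ContinuousAt V p :=
  hL.lipschitz.continuousOn.continuousAt (hL.field.isOpen.mem_nhds (hL.subset hp))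

lemma eventually_lt (hL : ProjectedLyapunov X K F V U) {C : NNReal} {z : ℝ → Eucl d}
    (hzK : ∀ t, z t ∈ K) (hz : LipschitzWith C z)
    (hder : ∀ t, 0 < t → ∀ v, HasDerivAt z v t →
      ∃ f ∈ F (z t), ∃ q : Eucl d, (∀ w ∈ K, inner ℝ q (w - z t) ≤ 0) ∧ v = f - q)
    (h0 : U (z 0) < 0) : ∀ᶠ t in 𝓝[>] (0 : ℝ), V (z t) < V (z 0) := by
  refine eventually_lt_of_ae_deriv_le hL.field.isOpen hL.subset hL.lipschitz
    hL.upperSemicontinuous hzK hz (fun t ht hdiff D hD => ?_) h0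
  obtain ⟨f, hf, q, hq, hv⟩ := hder t ht _ hdiff.hasDerivAt
  have hzX := hL.subset (hzK t)
  exact hL.lie_le _ (hzK t) D (mem_lieDeriv_of_hasDerivAt hL.field.isOpen hL.lipschitz hzX
    (hL.regular _ hzX) hdiff.hasDerivAt hD
    (mem_projField_of_hasDerivAt hzK hdiff.hasDerivAt hf hq hv))

/-- If `V` is constant on the limit points, then `U` vanishes there. -/
lemma eq_zero_of_constant (hL : ProjectedLyapunov X K F V U)
    (hR : NormalRecursion K F x g n E γ M N) (hγ : StepAssumption γ) (hM : 0 ≤ M) {c : ℝ}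
    (hc : ∀ p ∈ limitPoints x, V p = c) {p : Eucl d} (hp : p ∈ limitPoints x) : U p = 0 := by
  obtain ⟨𝒱, h𝒱, hlim⟩ := mapClusterPt_iff_ultrafilter.1 (mem_limitPoints_iff.1 hp)
  obtain ⟨m, z, hjm, -, -, hz, hz0, hzK, hlip, hder⟩ := hR.exists_limit_trajectory hγ hL.isCompact
    (fun p hp => hL.field.convex p (hL.subset hp))
    (fun p hp => hL.field.isCompact p (hL.subset hp)) hM 𝒱 h𝒱
  obtain rfl := tendsto_nhds_unique hz0 hlim
  by_contra hne
  obtain ⟨t, ht⟩ := (hL.eventually_lt hzK hlip hder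
    (lt_of_le_of_ne (hL.nonpos _ (hzK 0)) hne)).exists
  have hzt : z t ∈ limitPoints x :=
    mem_limitPoints_of_tendsto (tendsto_atTop_mono (fun j => hjm j t) h𝒱) (hz t)
  exact ht.ne ((hc _ hzt).trans (hc _ hp).symm)

/-- Every level crossed upwards infinitely often by `V (x k)` is attained at a limit point where
`U` vanishes. -/
lemma exists_limitPoint_of_frequently (hL : ProjectedLyapunov X K F V U)
    (hR : NormalRecursion K F x g n E γ M N) (hγ : StepAssumption γ) (hM : 0 ≤ M) {c c' : ℝ}
    (hc : c < c') (hlow : ∃ᶠ k in atTop, V (x k) < c) (hhigh : ∃ᶠ k in atTop, c' < V (x k)) :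
    ∃ p ∈ limitPoints x, p ∈ K ∧ U p = 0 ∧ V p = c := by
  have hfreq := frequently_upcrossing hc hlow hhigh
  have hne : NeBot _ := frequently_iff_neBot.1 hfreq
  obtain ⟨𝒱, hle⟩ := Ultrafilter.exists_le (atTop ⊓ 𝓟 {j | V (x j) ≤ c ∧
    ∃ k, j < k ∧ c' < V (x k) ∧ ∀ i, j < i → i ≤ k → c < V (x i)})
  have h𝒱 : ↑𝒱 ≤ (atTop : Filter ℕ) := hle.trans inf_le_left
  have hP : ∀ᶠ j in (𝒱 : Filter ℕ), V (x j) ≤ c ∧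
      ∃ k, j < k ∧ c' < V (x k) ∧ ∀ i, j < i → i ≤ k → c < V (x i) :=
    le_principal_iff.1 (hle.trans inf_le_right)
  have hid : Tendsto (fun j : ℕ => j) 𝒱 atTop := h𝒱
  have hlarge : ∀ i : ℕ, ∀ᶠ j in (𝒱 : Filter ℕ), i ≤ j := fun i =>
    hid.eventually (eventually_ge_atTop i)
  obtain ⟨m, z, hjm, hlt, hle, hz, hz0, hzK, hlip, hder⟩ := hR.exists_limit_trajectory hγ
    hL.isCompact (fun p hp => hL.field.convex p (hL.subset hp))
    (fun p hp => hL.field.isCompact p (hL.subset hp)) hM 𝒱 h𝒱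
  have hcont := hL.continuousAt (hzK 0)
  obtain ⟨s, hs⟩ := hR.converges
  have hγ0 : Tendsto (fun j => γ (j + 1)) 𝒱 (𝓝 0) :=
    (hγ.tendsto_zero.comp (tendsto_add_atTop_nat 1)).comp hid
  -- Consecutive iterates share their limit: `V (x j) ≤ c < V (x (j + 1))` then forces `V (z 0) =
  -- c`.
  have hnext : Tendsto (fun j => x (j + 1)) 𝒱 (𝓝 (z 0)) := by
    have h1 : Tendsto (fun j => 2 * M * γ (j + 1) + dist (E (j + 1)) (E j)) 𝒱 (𝓝 0) := by
      have h2 := ((hs.comp (tendsto_add_atTop_nat 1)).comp hid).dist (hs.comp hid)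
      simpa using (hγ0.const_mul (2 * M)).add h2
    have h2 : Tendsto (fun j => dist (x j) (x (j + 1))) 𝒱 (𝓝 0) := by
      refine squeeze_zero' (Eventually.of_forall fun _ => dist_nonneg) ?_ h1
      filter_upwards [hlarge N] with j hj
      have h3 := hR.dist_le hγ hj (Nat.le_succ j)
      rwa [Nat.succ_eq_add_one, elapsed_succ, add_sub_cancel_left, dist_comm] at h3
    exact hz0.congr_dist h2
  have hVp : V (z 0) = c := by
    refine le_antisymm (le_of_tendsto (hcont.tendsto.comp hz0) (hP.mono fun j hj => hj.1))
      (ge_of_tendsto (hcont.tendsto.comp hnext) (hP.mono fun j hj => ?_))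
    obtain ⟨k, hjk, -, h⟩ := hj.2
    exact (h (j + 1) (by omega) hjk).le
  refine ⟨z 0, mem_limitPoints_of_tendsto hid hz0, hzK 0, ?_, hVp⟩
  by_contra hne0
  have hdec := hL.eventually_lt hzK hlip hder (lt_of_le_of_ne (hL.nonpos _ (hzK 0)) hne0)
  obtain ⟨ρ, hρ, hball⟩ := Metric.eventually_nhds_iff_ball.1
    (hcont.eventually (gt_mem_nhds (hVp.trans_lt hc)))
  have hsmall : ∀ᶠ t in 𝓝[>] (0 : ℝ), 2 * M * t < ρ / 4 := by
    have : Tendsto (fun t : ℝ => 2 * M * t) (𝓝 0) (𝓝 (2 * M * 0)) :=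
      (continuous_const_mul (2 * M)).tendsto 0
    rw [mul_zero] at this
    exact (this.eventually (gt_mem_nhds (by positivity))).filter_mono nhdsWithin_le_nhds
  have hpos : ∀ᶠ t in 𝓝[>] (0 : ℝ), 0 < t := self_mem_nhdsWithin
  obtain ⟨t, hVt, htρ, ht⟩ := (hdec.and (hsmall.and hpos)).exists
  rw [hVp] at hVt
  obtain ⟨N₁, hN₁⟩ := Metric.cauchySeq_iff.1 hs.cauchySeq (ρ / 4) (by positivity)
  obtain ⟨j, ⟨-, k, hjk, hVk, hbetween⟩, hjN, hjN₁, hVm, hγt, hxj⟩ := (hP.and ((hlarge N).and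
    ((hlarge N₁).and ((((hL.continuousAt (hzK t)).tendsto.comp (hz t)).eventually
      (gt_mem_nhds hVt)).and ((hγ0.eventually (gt_mem_nhds ht)).and
      (hz0.eventually (Metric.ball_mem_nhds _ (show 0 < ρ / 4 by positivity)))))))).exists
  -- The first step is shorter than `t`, so the index does advance.
  have hjm' : j < m j t := by
    refine lt_of_le_of_ne (hjm j t) fun heq => ?_
    have h1 := hlt j t ht.le
    rw [← heq, elapsed_succ] at h1
    linarith
  -- At `m j t` the value is already below `c`, impossible while `V` stays above `c` up to `k`. So
  -- `c'` is exceeded within time `t`, too soon to leave the ball where `V < c'`.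
  have hkm : k < m j t := by
    by_contra! hmk
    exact (hbetween _ hjm' hmk).not_gt hVm
  have h1 := hR.dist_le hγ hjN hjk.le
  have h2 := hN₁ k (by omega) j hjN₁
  have h3 : 2 * M * (elapsed γ k - elapsed γ j) ≤ 2 * M * t := by
    gcongr
    linarith [hle j t ht.le, hγ.elapsed_strictMono hkm]
  have h4 : dist (x j) (z 0) < ρ / 4 := hxj
  have h5 : x k ∈ Metric.ball (z 0) ρ := by
    rw [Metric.mem_ball]
    linarith [dist_triangle (x k) (x j) (z 0)]
  exact lt_asymm hVk (hball _ h5)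

end ProjectedLyapunov

end

/-! ### The limit set theorem -/

theorem mainTheorem4 {d : ℕ} (X K : Set (Eucl d)) (F : Eucl d → Set (Eucl d))
    (x y : ℕ → Eucl d) (γ : ℕ → ℝ) (η e r : ℕ → Eucl d)
    (hK_convex : Convex ℝ K) (hK_compact : IsCompact K) (hKX : K ⊆ X)
    (hF : FieldAssumption X F) (hγ : StepAssumption γ)
    (hη : NoiseAssumption γ η e r) (hy : ApproxAssumption X x y)
    (hx : IsPPAD X K F x y γ η)
    (he : ∃ C : ℝ, ∀ k, 1 ≤ k → ‖e k‖ ≤ C)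
    (V U : Eucl d → ℝ)
    (hV_lip : LocallyLipschitzOn X V) (hV_reg : ∀ z ∈ X, ClarkeRegularAt V z)
    (hU : UpperSemicontinuousOn U X)
    (hLie : ∀ z ∈ K, ∀ a ∈ lieDeriv (projField K F) V z, a ≤ U z)
    (hU_nonpos : ∀ z ∈ K, U z ≤ 0)
    (S : Set (Eucl d)) (hS : S = {z | z ∈ X ∧ U z = 0}) :
    (∃ a b : ℝ, a ≤ b ∧ V '' limitPoints x = Set.Icc a b ∧ Set.Icc a b ⊆ V '' (S ∩ K)) ∧
    (interior (V '' (S ∩ K)) = ∅ →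
      (S ∩ K).Nonempty ∧ Tendsto (fun k => Metric.infDist (x k) (S ∩ K)) atTop (𝓝 0)) := by
  have hL : ProjectedLyapunov X K F V U :=
    ⟨hK_compact, hKX, hF, hV_lip, hV_reg, hU, hLie, hU_nonpos⟩
  obtain ⟨g, n, E, M, N, hM, hR⟩ :=
    hx.exists_normalRecursion hK_convex hK_compact hKX hF hγ hη hy he
  have hSK : S ∩ K = {p | p ∈ K ∧ U p = 0} := by
    rw [hS]
    ext p
    exact ⟨fun h => ⟨h.2, h.1.2⟩, fun h => ⟨⟨hKX h.1, h.2⟩, h.1⟩⟩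
  have hxK : ∀ᶠ k in atTop, x k ∈ K := eventually_atTop.2 ⟨N, hR.mem⟩
  obtain ⟨hΛ, hΛK, hΛne⟩ := isCompact_limitPoints hK_compact hxK
  have hVK : ContinuousOn V K := fun p hp => (hL.continuousAt hp).continuousWithinAt
  obtain ⟨pa, hpa, hmin⟩ := hΛ.exists_isMinOn hΛne (hVK.mono hΛK)
  obtain ⟨pb, hpb, hmax⟩ := hΛ.exists_isMaxOn hΛne (hVK.mono hΛK)
  have hab : V pa ≤ V pb := hmin hpb
  have hcross : ∀ c ∈ Ioo (V pa) (V pb), ∃ p ∈ limitPoints x, p ∈ K ∧ U p = 0 ∧ V p = c := by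
    intro c hc
    obtain ⟨c', hc1, hc2⟩ := exists_between hc.2
    obtain ⟨φ, hφ, hφa⟩ := id hpa
    obtain ⟨ψ, hψ, hψb⟩ := id hpb
    have h1 := ((hL.continuousAt (hΛK hpa)).tendsto.comp hφa).eventually (gt_mem_nhds hc.1)
    have h2 := ((hL.continuousAt (hΛK hpb)).tendsto.comp hψb).eventually (lt_mem_nhds hc2)
    exact hL.exists_limitPoint_of_frequently hR hγ hM hc1 (hφ.tendsto_atTop.frequently h1.frequently)
      (hψ.tendsto_atTop.frequently h2.frequently)
  have hcompact : IsCompact (S ∩ K) := hSK ▸ hL.isCompact_zeros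
  have hconst : V pa = V pb → limitPoints x ⊆ S ∩ K := fun heq p hp => by
    rw [hSK]
    exact ⟨hΛK hp, hL.eq_zero_of_constant hR hγ hM
      (fun q hq => le_antisymm ((hmax hq).trans_eq heq.symm) (hmin hq)) hp⟩
  have hIoo : Ioo (V pa) (V pb) ⊆ V '' (S ∩ K) := fun c hc => by
    obtain ⟨p, -, hpK, hUp, hVp⟩ := hcross c hc
    exact ⟨p, hSK ▸ ⟨hpK, hUp⟩, hVp⟩
  refine ⟨⟨V pa, V pb, hab, Subset.antisymm ?_ fun c hc => ?_, ?_⟩, fun hint => ?_⟩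
  · rintro _ ⟨p, hp, rfl⟩
    exact ⟨hmin hp, hmax hp⟩
  · rcases hc.1.eq_or_lt with rfl | h1
    · exact ⟨pa, hpa, rfl⟩
    rcases hc.2.eq_or_lt with rfl | h2
    · exact ⟨pb, hpb, rfl⟩
    obtain ⟨p, hp, -, -, hVp⟩ := hcross c ⟨h1, h2⟩
    exact ⟨p, hp, hVp⟩
  · rcases hab.eq_or_lt with heq | hlt
    · rw [← heq, Icc_self, singleton_subset_iff]
      exact ⟨pa, hconst heq hpa, rfl⟩
    -- The crossing argument misses the two extreme values; closedness of `V '' (S ∩ K)` recovers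
    -- them.
    · rw [← closure_Ioo hlt.ne]
      exact closure_minimal hIoo
        (hcompact.image_of_continuousOn (hVK.mono inter_subset_right)).isClosed
  · have heq : V pa = V pb := by
      refine hab.eq_of_not_lt fun hlt => ?_
      obtain ⟨c, hc⟩ := exists_between hlt
      have h1 := interior_maximal hIoo isOpen_Ioo hc
      rw [hint] at h1
      exact h1
    -- Along any ultrafilter the iterates converge in `K`, to a limit point and hence into `S ∩ K`.
    refine ⟨⟨pa, hconst heq hpa⟩, tendsto_iff_ultrafilter _ _ _ |>.2 fun 𝒱 h𝒱 => ?_⟩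
    obtain ⟨p, -, hp⟩ := hK_compact.ultrafilter_le_nhds (𝒱.map x) (le_principal_iff.2 (h𝒱 hxK))
    have hp' : Tendsto x 𝒱 (𝓝 p) := hp
    have hmem := hconst heq (mem_limitPoints_of_tendsto (u := fun k => k) h𝒱 hp')
    rw [← Metric.infDist_zero_of_mem hmem]
    exact ((Metric.continuous_infDist_pt (S ∩ K)).tendsto p).comp hp'
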